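/- **Definitions.** Let $\mathbb{T}$ be the torus, i.e. the interval $[0,1]$ with $0$ and $1$ identified. For $a,b\in[0,1]$ with $a\neq b$, the interval $[a,b]\subseteq\mathbb{T}$ is the usual interval if $a<b$, of length $b-a$, and is $[0,b]\cup[a,1]$ if $a>b$, of length $1-a+b$. For $d\in\mathbb{N}$ let $\mathcal{B}^d_{\mathrm{per}}$ be the family of axis-parallel boxes $[a_1,b_1]\times\cdots\times[a_d,b_d]\subseteq\mathbb{T}^d$ with $a_i,b_i\in[0,1]$ and $a_i\neq b_i$ for all $i$, and let $\mathcal{C}^d_{\mathrm{per}}$ be the subfamily of axis-parallel cubes, i.e. those boxes whose intervals $[a_1,b_1],\dots,[a_d,b_d]$ all have the same length. A family $H$ of sets shatters a finite set $C$ if every subset of $C$ has the form $h\cap C$ with $h\in H$; the VC-dimension $\mathrm{VC}(H)$ is the largest integer $D$ such that some set of cardinality $D$ is shattered by $H$. **Theorem 1.** There is $d_0$ such that for all integers $d\ge d_0$ the VC-dimensions of $\mathcal{C}^d_{\mathrm{per}}$ and $\mathcal{B}^d_{\mathrm{per}}$ exist (are finite) and $$d\bigl(\log_2 d-4\log_2\log_2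 d\bigr)\le \mathrm{VC}(\mathcal{C}^d_{\mathrm{per}})\le \mathrm{VC}(\mathcal{B}^d_{\mathrm{per}})\le d\bigl(\log_2 d+3\log_2\log_2 d\bigr).$$ In particular, as $d\to\infty$, $\mathrm{VC}(\mathcal{B}^d_{\mathrm{per}})\sim \mathrm{VC}(\mathcal{C}^d_{\mathrm{per}})\sim d\log_2 d$, where $f\sim g$ means that $f(d)/g(d)\to1$. -/

import Mathlib

/-- A set family `H` shatters the finite set `C`: every subset of `C` is of the form `h ∩ C`
with `h ∈ H`. -/
def ShattersFinset {α : Type*} (H : Set (Set α)) (C : Finset α) : Prop :=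
  ∀ t : Set α, t ⊆ (C : Set α) → ∃ h ∈ H, h ∩ (C : Set α) = t

/-- The cardinalities of the finite sets shattered by `H`. -/
def shatteredCards {α : Type*} (H : Set (Set α)) : Set ℕ :=
  {D : ℕ | ∃ C : Finset α, C.card = D ∧ ShattersFinset H C}

/-- The VC-dimension of `H`: the largest cardinality of a set shattered by `H`. It is meaningful
when that largest cardinality exists, that is, when
`IsGreatest (shatteredCards H) (vcDim H)` holds. -/
noncomputable def vcDim {α : Type*} (H : Set (Set α)) : ℕ :=
  sSup (shatteredCards H)

/-- The closed interval `[a, b]` on the torus `ℝ / ℤ` (the interval `[0, 1]` with `0` and `1`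
identified), for `a, b ∈ [0, 1]`: the usual interval if `a < b`, and `[0, b] ∪ [a, 1]` if
`a > b`. -/
noncomputable def torusInterval (a b : ℝ) : Set UnitAddCircle :=
  (fun x : ℝ => (x : UnitAddCircle)) ''
    (if a < b then Set.Icc a b else Set.Icc 0 b ∪ Set.Icc a 1)

/-- The length of the interval `[a, b]` on the torus. -/
noncomputable def torusIntervalLength (a b : ℝ) : ℝ :=
  if a < b then b - a else 1 - a + b

/-- The `d`-dimensional axis-parallel boxes on the torus: products
`[a₁, b₁] × ⋯ × [a_d, b_d]` with `0 ≤ aᵢ ≠ bᵢ ≤ 1`. -/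
def periodicBoxes (d : ℕ) : Set (Set (Fin d → UnitAddCircle)) :=
  {h | ∃ a b : Fin d → ℝ,
    (∀ i, a i ∈ Set.Icc (0 : ℝ) 1 ∧ b i ∈ Set.Icc (0 : ℝ) 1 ∧ a i ≠ b i) ∧
    h = Set.univ.pi (fun i => torusInterval (a i) (b i))}

/-- The `d`-dimensional axis-parallel cubes on the torus: boxes all of whose intervals have the
same length. -/
def periodicCubes (d : ℕ) : Set (Set (Fin d → UnitAddCircle)) :=
  {h | ∃ a b : Fin d → ℝ,
    (∀ i, a i ∈ Set.Icc (0 : ℝ) 1 ∧ b i ∈ Set.Icc (0 : ℝ) 1 ∧ a i ≠ b i) ∧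
    (∀ i j, torusIntervalLength (a i) (b i) = torusIntervalLength (a j) (b j)) ∧
    h = Set.univ.pi (fun i => torusInterval (a i) (b i))}

/-! Upper bound. The complement of a torus interval is an open arc. An arc cuts a finite set `C` in
an initial segment of the cyclic order starting at one of its points, so for a fixed coordinate and
starting point the possible traces form a chain. The part of `C` missed by a box is a union of `d`
such traces. Besides the `d` starting points, it is determined by the cardinalities of the
successive partial unions, so a shattered set of size `n` satisfies `2 ^ n ≤ n ^ d * (n + d).choose
d` (`two_pow_card_le_of_chains`). Solving for `n` gives the bound.

Lower bound. Take `G` clusters of `k` points. In each coordinate the clusters sit at different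
levels, and a `d × G` array of subsets of `Fin k` says which points of a cluster are at its level
and which are parked at `0`. A cube with a small hole in each coordinate removes, per coordinate,
one array entry from one cluster. To cut out an arbitrary set, each cluster needs its own coordinate
whose entry is exactly the part to be removed: a system of distinct rows. A uniformly random array
admits one for all prescriptions at once with positive probability, by Hall's theorem and a union
bound (`exists_array_of_lt_one`). -/

/-! ### Random arrays and Hall's condition -/

open Finset in
theorem card_filter_forall_ne_le {P Q : Type*} [Fintype P] [DecidableEq P] [Fintype Q]
    [DecidableEq Q] [Nonempty Q] (S : Finset P) (y : P → Q) :
    ((univ.filter fun F : P → Q => ∀ p ∈ S, F p ≠ y p).card : ℝ) ≤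
      (Fintype.card Q : ℝ) ^ Fintype.card P * (1 - 1 / (Fintype.card Q : ℝ)) ^ S.card := by
  have hq : (0 : ℝ) < Fintype.card Q := by exact_mod_cast Fintype.card_pos
  have h : (univ.filter fun F : P → Q => ∀ p ∈ S, F p ≠ y p) =
      Fintype.piFinset (fun p => if p ∈ S then univ.erase (y p) else univ) := by
    ext F
    simp only [mem_filter, mem_univ, true_and, Fintype.mem_piFinset]
    refine forall_congr' fun p => ?_
    by_cases hp : p ∈ S <;> simp [hp]
  rw [h, Fintype.card_piFinset, Nat.cast_prod]
  have h2 : ∀ p : P, (((if p ∈ S then univ.erase (y p) else univ : Finset Q).card : ℕ) : ℝ) =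
      (Fintype.card Q : ℝ) * (if p ∈ S then 1 - 1 / (Fintype.card Q : ℝ) else 1) := by
    intro p
    by_cases hp : p ∈ S
    · simp only [hp, if_true, card_erase_of_mem (mem_univ _), card_univ]
      rw [Nat.cast_sub Fintype.card_pos]
      field_simp
      simp
    · simp [hp]
  rw [prod_congr rfl fun p _ => h2 p, prod_mul_distrib, prod_const, card_univ]
  simp

/-- If `F` has no system of distinct rows realizing `x`, Hall's condition fails on some set of
columns, enumerated by `A`, whose matching rows are all enumerated by `D`. -/
theorem exists_hall_obstruction {d G : ℕ} {Q : Type*} [DecidableEq Q] (hG : G ≤ d)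
    (F : Fin d × Fin G → Q) (x : Fin G → Q)
    (hx : ¬ ∃ m : Fin G → Fin d, Function.Injective m ∧ ∀ g, F (m g, g) = x g) :
    ∃ a ∈ Finset.Icc 1 G, ∃ T : (Fin a → Fin G) × (Fin a → Fin d) × (Fin a → Q),
      Function.Injective T.1 ∧
      ∀ i ∉ Finset.univ.image T.2.1, ∀ j, F (i, T.1 j) ≠ T.2.2 j := by
  classical
  set t : Fin G → Finset (Fin d) := fun g => Finset.univ.filter fun i => F (i, g) = x g with ht
  have hall := (Finset.all_card_le_biUnion_card_iff_exists_injective t).not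
  have : ¬ ∃ f : Fin G → Fin d, Function.Injective f ∧ ∀ g, f g ∈ t g := by
    simpa [ht] using hx
  obtain ⟨s, hs⟩ := not_forall.1 (hall.2 this)
  push Not at hs
  have hsG : s.card ≤ G := by simpa using s.card_le_univ
  have hs1 : 1 ≤ s.card := by omega
  have hd : 0 < d := by omega
  obtain ⟨D, hD⟩ : ∃ D : Fin s.card → Fin d, s.biUnion t ⊆ Finset.univ.image D := by
    set B := s.biUnion t
    -- There are fewer than `s.card` matching rows; the spare slots are padded with row `0`, which
    -- only excludes one more row.
    refine ⟨fun j => if h : j.val < B.card then (B.equivFin.symm ⟨j, h⟩ : Fin d) else ⟨0, hd⟩, ?_⟩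
    intro b hb
    refine Finset.mem_image.2 ⟨⟨B.equivFin ⟨b, hb⟩, by
      have := (B.equivFin ⟨b, hb⟩).2; omega⟩, Finset.mem_univ _, ?_⟩
    simp
  refine ⟨s.card, Finset.mem_Icc.2 ⟨hs1, hsG⟩,
    (fun j => (s.equivFin.symm j : Fin G), D, fun j => x (s.equivFin.symm j)), ?_, ?_⟩
  · intro i j hij
    exact s.equivFin.symm.injective (Subtype.ext hij)
  · intro i hi j hF
    apply hi
    apply hD
    exact Finset.mem_biUnion.2 ⟨_, (s.equivFin.symm j).2, by simpa [ht] using hF⟩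

open Finset in
/-- There is a `d × G` array such that every sequence of `G` symbols can be read off, column by
column, from pairwise distinct rows. -/
theorem exists_array_of_lt_one (d G : ℕ) (Q : Type*) [Fintype Q] [DecidableEq Q] [Nonempty Q]
    (hG : G ≤ d)
    (h : (G : ℝ) * (G * d * Fintype.card Q *
      (1 - 1 / (Fintype.card Q : ℝ)) ^ (d - G)) < 1) :
    ∃ F : Fin d × Fin G → Q, ∀ x : Fin G → Q,
      ∃ m : Fin G → Fin d, Function.Injective m ∧ ∀ g, F (m g, g) = x g := by
  classical
  by_contra hcon
  push Not at hcon
  rcases Nat.eq_zero_or_pos G with rfl | hGpos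
  · obtain ⟨x, hx⟩ := hcon (fun _ => Classical.arbitrary Q)
    obtain ⟨g, -⟩ := hx (fun g => g.elim0) (fun g => g.elim0)
    exact g.elim0
  set q : ℝ := (Fintype.card Q : ℝ) with hqdef
  have hq : (1 : ℝ) ≤ q := by
    rw [hqdef]; exact_mod_cast (Fintype.card_pos : 0 < Fintype.card Q)
  set ρ : ℝ := 1 - 1 / q with hρ
  have hρ0 : 0 ≤ ρ := by
    have : 1 / q ≤ 1 := by rw [div_le_one (by linarith)]; exact hq
    linarith
  have hρ1 : ρ ≤ 1 := by
    have : 0 ≤ 1 / q := by positivity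
    linarith
  set bad : (a : ℕ) → (Fin a → Fin G) × (Fin a → Fin d) × (Fin a → Q) →
      Finset (Fin d × Fin G → Q) := fun a T => univ.filter fun F =>
        Function.Injective T.1 ∧ ∀ i ∉ univ.image T.2.1, ∀ j, F (i, T.1 j) ≠ T.2.2 j with hbad
  have hcover : (univ : Finset (Fin d × Fin G → Q)) ⊆
      (Icc 1 G).biUnion fun a => univ.biUnion (bad a) := by
    intro F _
    obtain ⟨x, hx⟩ := hcon F
    obtain ⟨a, ha, T, hT⟩ := exists_hall_obstruction hG F x (by push Not; exact hx)
    exact mem_biUnion.2 ⟨a, ha, mem_biUnion.2 ⟨T, mem_univ _, by simpa [hbad] using hT⟩⟩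
  have hone : ∀ a ∈ Icc 1 G, ∀ T, ((bad a T).card : ℝ) ≤ q ^ (d * G) * (ρ ^ (d - G)) ^ a := by
    intro a ha T
    rw [mem_Icc] at ha
    by_cases hinj : Function.Injective T.1
    · set S : Finset (Fin d × Fin G) := (univ.image T.2.1)ᶜ ×ˢ univ.image T.1 with hS
      set y : Fin d × Fin G → Q :=
        fun p => Function.extend T.1 T.2.2 (fun _ => Classical.arbitrary Q) p.2 with hy
      have hsub : bad a T ⊆ univ.filter fun F : Fin d × Fin G → Q => ∀ p ∈ S, F p ≠ y p := by
        intro F hF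
        simp only [hbad, mem_filter, mem_univ, true_and] at hF ⊢
        rintro ⟨i, g⟩ hp
        rw [hS, mem_product, mem_compl] at hp
        obtain ⟨j, -, rfl⟩ := mem_image.1 hp.2
        rw [hy]
        simp only [hinj.extend_apply]
        exact hF.2 i hp.1 j
      -- At least `d - a ≥ d - G` rows lie outside the image of `T.2.1`, and injectivity gives `a`
      -- distinct columns.
      have hScard : (d - G) * a ≤ S.card := by
        rw [hS, card_product, card_image_of_injective _ hinj, card_compl]
        have : (univ.image T.2.1).card ≤ a := by simpa using card_image_le (s := univ) (f := T.2.1)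
        simp only [card_univ, Fintype.card_fin]
        exact Nat.mul_le_mul_right _ (by omega)
      calc ((bad a T).card : ℝ) ≤ _ := by exact_mod_cast card_le_card hsub
        _ ≤ q ^ Fintype.card (Fin d × Fin G) * ρ ^ S.card := card_filter_forall_ne_le S y
        _ ≤ q ^ (d * G) * (ρ ^ (d - G)) ^ a := by
          rw [Fintype.card_prod, Fintype.card_fin, Fintype.card_fin, ← pow_mul]
          exact mul_le_mul_of_nonneg_left (pow_le_pow_of_le_one hρ0 hρ1 hScard) (by positivity)
    · have : bad a T = ∅ := by simp [hbad, hinj]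
      rw [this]
      simp only [card_empty, Nat.cast_zero]
      positivity
  -- There are `(G d q) ^ a` choices of `T`, so obstructions of size `a` have total proportion at
  -- most `z ^ a ≤ z`; the `G` possible sizes give `G * z < 1`.
  set z : ℝ := G * d * q * ρ ^ (d - G) with hz
  have hz0 : 0 ≤ z := by positivity
  have hG1 : (1 : ℝ) ≤ G := by exact_mod_cast hGpos
  have hz1 : z ≤ 1 := by nlinarith
  have hsum : ((univ : Finset (Fin d × Fin G → Q)).card : ℝ) ≤ q ^ (d * G) * (G * z) := by
    calc ((univ : Finset (Fin d × Fin G → Q)).card : ℝ)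
        ≤ ∑ a ∈ Icc 1 G, ∑ T, ((bad a T).card : ℝ) := by
          exact_mod_cast (card_le_card hcover).trans
            (card_biUnion_le.trans (sum_le_sum fun a _ => card_biUnion_le))
      _ ≤ ∑ a ∈ Icc 1 G, q ^ (d * G) * z := by
          refine sum_le_sum fun a ha => ?_
          refine (sum_le_sum fun T _ => hone a ha T).trans ?_
          rw [sum_const, card_univ, nsmul_eq_mul]
          simp only [Fintype.card_prod, Fintype.card_fun, Fintype.card_fin, Nat.cast_mul,
            Nat.cast_pow]
          have : z ^ a ≤ z := pow_le_of_le_one hz0 hz1 (by rw [mem_Icc] at ha; omega)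
          calc ((G : ℝ) ^ a * (d ^ a * q ^ a)) * (q ^ (d * G) * (ρ ^ (d - G)) ^ a)
              = q ^ (d * G) * z ^ a := by rw [hz]; ring
            _ ≤ _ := mul_le_mul_of_nonneg_left this (by positivity)
      _ = _ := by rw [sum_const, Nat.card_Icc, nsmul_eq_mul, Nat.add_sub_cancel]; ring
  have hcard : ((univ : Finset (Fin d × Fin G → Q)).card : ℝ) = q ^ (d * G) := by
    rw [card_univ, Fintype.card_fun]
    simp [hqdef]
  rw [hcard] at hsum
  have hpos : 0 < q ^ (d * G) := by positivity
  nlinarith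

/-! ### Shattering by cubes with one hole per coordinate -/

/-- The points with coordinates in `[0, 1)` outside a torus interval wrapping through `0`. -/
theorem coe_mem_torusInterval_of_lt {a b y : ℝ} (hb : 0 ≤ b) (hba : b < a)
    (hy0 : 0 ≤ y) (hy1 : y < 1) :
    (y : UnitAddCircle) ∈ torusInterval a b ↔ ¬ (b < y ∧ y < a) := by
  rw [torusInterval, if_neg (not_lt.2 hba.le)]
  constructor
  · rintro ⟨x, hx, hxy⟩ ⟨h1, h2⟩
    have hxy : (x : UnitAddCircle) = y := hxy
    have hx01 : 0 ≤ x ∧ x ≤ 1 := by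
      rcases hx with hx | hx
      · exact ⟨hx.1, by linarith [hx.2]⟩
      · exact ⟨by linarith [hx.1], hx.2⟩
    rcases hx01.2.lt_or_eq with hlt | rfl
    · have : x = y := (AddCircle.coe_eq_coe_iff_of_mem_Ico (p := (1 : ℝ)) (a := 0)
        ⟨hx01.1, by simpa using hlt⟩ ⟨hy0, by simpa using hy1⟩).1 hxy
      subst this
      rcases hx with hx | hx
      · linarith [hx.2]
      · linarith [hx.1]
    · rw [AddCircle.coe_period, ← AddCircle.coe_zero] at hxy
      have : (0 : ℝ) = y := (AddCircle.coe_eq_coe_iff_of_mem_Ico (p := (1 : ℝ)) (a := 0)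
        ⟨le_rfl, by simp⟩ ⟨hy0, by simpa using hy1⟩).1 hxy
      linarith
  · intro h
    refine ⟨y, ?_, rfl⟩
    by_cases hy : y ≤ b
    · exact Or.inl ⟨hy0, hy⟩
    · exact Or.inr ⟨not_lt.1 fun h' => h ⟨not_le.1 hy, h'⟩, hy1.le⟩

theorem card_mem_shatteredCards {α ι : Type*} [Fintype ι] (H : Set (Set α)) (p : ι → α)
    (h : ∀ E : Set ι, ∃ s ∈ H, ∀ e, p e ∈ s ↔ e ∈ E) :
    Fintype.card ι ∈ shatteredCards H := by
  classical
  -- Cutting out a singleton separates its index from all others.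
  have hinj : Function.Injective p := by
    intro e e' hee
    obtain ⟨s, -, hs⟩ := h {e}
    exact ((hs e').1 (hee ▸ (hs e).2 rfl)).symm
  refine ⟨Finset.univ.image p, by rw [Finset.card_image_of_injective _ hinj, Finset.card_univ], ?_⟩
  intro t ht
  obtain ⟨s, hsH, hs⟩ := h (p ⁻¹' t)
  refine ⟨s, hsH, ?_⟩
  ext x
  constructor
  · rintro ⟨hx, hxC⟩
    obtain ⟨e, rfl⟩ : ∃ e, p e = x := by simpa using hxC
    exact (hs e).1 hx
  · intro hx
    refine ⟨?_, ht hx⟩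
    obtain ⟨e, rfl⟩ : ∃ e, p e = x := by simpa using ht hx
    exact (hs e).2 hx

/-- Complements of single clusters of an array are cut out by cubes. -/
theorem mul_mem_shatteredCards_periodicCubes {d G k : ℕ} (F : Fin d × Fin G → Set (Fin k))
    (hF : ∀ x : Fin G → Set (Fin k),
      ∃ m : Fin G → Fin d, Function.Injective m ∧ ∀ g, F (m g, g) = x g) :
    G * k ∈ shatteredCards (periodicCubes d) := by
  classical
  have hN : (0 : ℝ) < G + 2 := by positivity
  -- Column `g` has level `(g + 1) / (G + 2)`; the denominator leaves room for one unused level `(G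
  -- + 1) / (G + 2)` and its hole inside `[0, 1]`.
  set y : Fin G × Fin k → Fin d → ℝ :=
    fun e i => if e.2 ∈ F (i, e.1) then ((e.1 : ℝ) + 1) / (G + 2) else 0 with hy
  have key := card_mem_shatteredCards (ι := Fin G × Fin k) (periodicCubes d)
    (fun e i => (y e i : UnitAddCircle)) ?_
  · simpa using key
  intro E
  obtain ⟨m, hm, hmx⟩ := hF fun g => {j | (g, j) ∉ E}
  -- Row `m g` gets its hole at level `g`; unmatched rows get it at the spare level `G`, where there
  -- are no points.
  set c : Fin d → ℕ := fun i => if h : ∃ g, m g = i then (h.choose : ℕ) else G with hc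
  have hcG : ∀ i, c i ≤ G := by
    intro i
    simp only [hc]
    split_ifs with h
    · exact h.choose.2.le
    · exact le_rfl
  have hcm : ∀ g, c (m g) = g := by
    intro g
    have h : ∃ g', m g' = m g := ⟨g, rfl⟩
    simp only [hc, dif_pos h]
    rw [hm h.choose_spec]
  have hcinv : ∀ i (g : Fin G), c i = g → m g = i := by
    intro i g hg
    by_cases h : ∃ g', m g' = i
    · obtain ⟨g', rfl⟩ := h
      rw [hcm] at hg
      rw [Fin.ext hg]
    · simp only [hc, dif_neg h] at hg
      exact absurd hg (by have := g.2; omega)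
  -- The hole `(b i, a i)` has width `1 / (G + 2)` and is centred at level `c i`, so it contains no
  -- other level.
  set b : Fin d → ℝ := fun i => ((c i : ℝ) + 1 / 2) / (G + 2) with hb
  set a : Fin d → ℝ := fun i => ((c i : ℝ) + 3 / 2) / (G + 2) with ha
  have hcG' : ∀ i, (c i : ℝ) ≤ G := fun i => by exact_mod_cast hcG i
  have hb0 : ∀ i, 0 ≤ b i := fun i => by positivity
  have ha1 : ∀ i, a i ≤ 1 := fun i => by
    rw [ha]; simp only; rw [div_le_one hN]; linarith [hcG' i]
  have hba : ∀ i, b i < a i := fun i => by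
    simp only [ha, hb]; gcongr; norm_num
  have hlen : ∀ i, torusIntervalLength (a i) (b i) = 1 - 1 / (G + 2) := by
    intro i
    rw [torusIntervalLength, if_neg (not_lt.2 (hba i).le)]
    simp only [ha, hb]
    field_simp
    ring
  refine ⟨_, ⟨a, b, fun i => ⟨⟨(hb0 i).trans (hba i).le, ha1 i⟩,
    ⟨hb0 i, (hba i).le.trans (ha1 i)⟩, (hba i).ne'⟩, fun i j => by rw [hlen, hlen], rfl⟩, ?_⟩
  rintro ⟨g, j⟩
  have hgG : ((g : ℕ) : ℝ) + 1 ≤ G := by exact_mod_cast g.2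
  have hy0 : ∀ i, 0 ≤ y (g, j) i := fun i => by simp only [hy]; split_ifs <;> positivity
  have hy1 : ∀ i, y (g, j) i < 1 := fun i => by
    simp only [hy]
    split_ifs
    · rw [div_lt_one hN]; linarith
    · exact one_pos
  have hout : ∀ i, (b i < y (g, j) i ∧ y (g, j) i < a i) ↔ (j ∈ F (i, g) ∧ c i = g) := by
    intro i
    simp only [hy]
    split_ifs with hj
    · simp only [hj, true_and, ha, hb]
      rw [div_lt_div_iff_of_pos_right hN, div_lt_div_iff_of_pos_right hN]
      constructor
      · rintro ⟨h1, h2⟩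
        have h3 : (c i : ℝ) < (g : ℕ) + 1 := by linarith
        have h4 : ((g : ℕ) : ℝ) < c i + 1 := by linarith
        have h3 : c i < g + 1 := by exact_mod_cast h3
        have h4 : (g : ℕ) < c i + 1 := by exact_mod_cast h4
        omega
      · intro h
        rw [h]
        constructor <;> linarith
    · simp only [hj, false_and, iff_false, not_and, not_lt]
      intro h
      exact absurd h (not_lt.2 (hb0 i))
  simp only [Set.mem_univ_pi]
  have hmem : ∀ i, (y (g, j) i : UnitAddCircle) ∈ torusInterval (a i) (b i) ↔
      ¬ (j ∈ F (i, g) ∧ c i = g) := fun i => by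
    rw [coe_mem_torusInterval_of_lt (hb0 i) (hba i) (hy0 i) (hy1 i), hout]
  have hjm : j ∈ F (m g, g) ↔ (g, j) ∉ E := by rw [hmx]; rfl
  constructor
  · intro h
    by_contra hE
    exact (hmem (m g)).1 (h (m g)) ⟨hjm.2 hE, hcm g⟩
  · intro hE i
    rw [hmem]
    rintro ⟨hj, hcg⟩
    rw [← hcinv i g hcg] at hj
    exact hjm.1 hj hE

/-! ### Counting unions of members of chains -/

/-- Induction on the partial unions: once they agree, adjoining comparable sets yields nested
unions, and nested finite sets of equal cardinality coincide. -/
theorem biUnion_eq_of_card_eq {α : Type*} [DecidableEq α] {d : ℕ} (X Y : Fin d → Finset α)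
    (hXY : ∀ i, X i ⊆ Y i ∨ Y i ⊆ X i)
    (hcard : ∀ i : Fin d, ((Finset.univ.filter (· ≤ i)).biUnion X).card =
      ((Finset.univ.filter (· ≤ i)).biUnion Y).card) :
    Finset.univ.biUnion X = Finset.univ.biUnion Y := by
  have key : ∀ j : ℕ, (Finset.univ.filter fun i : Fin d => i.val < j).biUnion X =
      (Finset.univ.filter fun i : Fin d => i.val < j).biUnion Y := by
    intro j
    induction j with
    | zero => simp
    | succ j ih =>
      by_cases hj : j < d
      · have hins : (Finset.univ.filter fun i : Fin d => i.val < j + 1) =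
            insert ⟨j, hj⟩ (Finset.univ.filter fun i : Fin d => i.val < j) := by
          ext i
          simp only [Finset.mem_filter, Finset.mem_univ, true_and, Finset.mem_insert, Fin.ext_iff]
          omega
        have hle : (Finset.univ.filter fun i : Fin d => i.val < j + 1) =
            Finset.univ.filter (· ≤ (⟨j, hj⟩ : Fin d)) := by
          ext i
          simp only [Finset.mem_filter, Finset.mem_univ, true_and, Fin.le_def]
          omega
        have hc := hcard ⟨j, hj⟩
        rw [← hle, hins, Finset.biUnion_insert, Finset.biUnion_insert, ih] at hc
        rw [hins, Finset.biUnion_insert, Finset.biUnion_insert, ih]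
        rcases hXY ⟨j, hj⟩ with h | h
        · exact Finset.eq_of_subset_of_card_le (Finset.union_subset_union_left h) hc.ge
        · exact (Finset.eq_of_subset_of_card_le (Finset.union_subset_union_left h) hc.le).symm
      · have : (Finset.univ.filter fun i : Fin d => i.val < j + 1) =
            Finset.univ.filter fun i : Fin d => i.val < j := by
          ext i
          have := i.2
          simp only [Finset.mem_filter, Finset.mem_univ, true_and]
          omega
        rw [this, ih]
  have huniv : (Finset.univ.filter fun i : Fin d => i.val < d) = Finset.univ := by
    ext i; simp
  simpa only [huniv] using key d

/-- If every subset of `C` is a union of `d` sets, the `i`-th of which belongs to one of `#C`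
chains, then `#C` is bounded. -/
theorem two_pow_card_le_of_chains {α : Type*} [Nonempty α] [DecidableEq α] {d : ℕ} (C : Finset α)
    (chain : Fin d → α → Set (Finset α)) (hchain : ∀ i s, IsChain (· ⊆ ·) (chain i s))
    (h : ∀ t ⊆ C, ∃ (s : Fin d → α) (X : Fin d → Finset α), (∀ i, s i ∈ C) ∧
      (∀ i, X i ∈ chain i (s i)) ∧ Finset.univ.biUnion X = t) :
    2 ^ C.card ≤ C.card ^ d * (C.card + d).choose d := by
  classical
  choose! s X hs hX ht using h
  -- Adding `i` makes the weakly increasing cardinalities strictly increasing, so they are recovered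
  -- from their set of values, a `d`-subset of `range (C.card + d)`.
  set c : Finset α → Fin d → ℕ :=
    fun t i => ((Finset.univ.filter (· ≤ i)).biUnion (X t)).card + i with hc
  have hmono : ∀ t, StrictMono (c t) := by
    intro t i j hij
    have : ((Finset.univ.filter (· ≤ i)).biUnion (X t)).card ≤
        ((Finset.univ.filter (· ≤ j)).biUnion (X t)).card := by
      refine Finset.card_le_card (Finset.biUnion_subset_biUnion_of_subset_left _ ?_)
      intro l hl
      simp only [Finset.mem_filter, Finset.mem_univ, true_and] at hl ⊢
      exact hl.trans hij.le
    have h2 : i.val < j.val := hij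
    simp only [hc]
    omega
  have hlt : ∀ t ⊆ C, ∀ i, c t i < C.card + d := by
    intro t htC i
    have : (Finset.univ.filter (· ≤ i)).biUnion (X t) ⊆ C := by
      refine Finset.Subset.trans
        (Finset.biUnion_subset_biUnion_of_subset_left _ (Finset.subset_univ _)) ?_
      rw [ht t htC]
      exact htC
    have := Finset.card_le_card this
    have := i.2
    simp only [hc]
    omega
  set T : Finset ((Fin d → α) × Finset ℕ) :=
    (Fintype.piFinset fun _ => C) ×ˢ (Finset.range (C.card + d)).powersetCard d with hT
  have hmaps : Set.MapsTo (fun t => (s t, Finset.univ.image (c t)))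
      (C.powerset : Set (Finset α)) T := by
    intro t htC
    have htC : t ⊆ C := by simpa using htC
    simp only [hT, Finset.coe_product, Set.mem_prod, Finset.mem_coe, Fintype.mem_piFinset,
      Finset.mem_powersetCard]
    refine ⟨hs t htC, ?_, ?_⟩
    · intro x hx
      obtain ⟨i, -, rfl⟩ := Finset.mem_image.1 hx
      exact Finset.mem_range.2 (hlt t htC i)
    · rw [Finset.card_image_of_injective _ (hmono t).injective]
      simp
  have hinj : Set.InjOn (fun t => (s t, Finset.univ.image (c t)))
      (C.powerset : Set (Finset α)) := by
    intro t htC t' htC' heq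
    have htC : t ⊆ C := by simpa using htC
    have htC' : t' ⊆ C := by simpa using htC'
    simp only [Prod.mk.injEq] at heq
    have hcc : c t = c t' := by
      refine ((hmono t).range_inj (hmono t')).1 ?_
      simpa using congrArg (fun u : Finset ℕ => (u : Set ℕ)) heq.2
    rw [← ht t htC, ← ht t' htC']
    refine biUnion_eq_of_card_eq _ _ (fun i => ?_) (fun i => ?_)
    · have h1 := hX t htC i
      have h2 := hX t' htC' i
      rw [← heq.1] at h2
      exact (hchain i _).total h1 h2
    · have := congrFun hcc i
      simp only [hc] at this
      omega
  have := Finset.card_le_card_of_injOn _ hmaps hinj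
  simpa [hT, Finset.card_powerset, Finset.card_powersetCard] using this

/-! ### Arcs on the torus and the bound for boxes -/

/-- The length of the positively oriented arc from `u` to `v`. -/
noncomputable def torusGap (u v : UnitAddCircle) : ℝ := AddCircle.equivIco 1 0 (v - u)

theorem torusGap_nonneg (u v : UnitAddCircle) : 0 ≤ torusGap u v :=
  (AddCircle.equivIco 1 0 (v - u)).2.1

theorem torusGap_lt_one (u v : UnitAddCircle) : torusGap u v < 1 :=
  (AddCircle.equivIco 1 0 (v - u)).2.2.trans_eq (zero_add 1)

theorem coe_torusGap (u v : UnitAddCircle) : (torusGap u v : UnitAddCircle) = v - u :=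
  (AddCircle.equivIco 1 0).symm_apply_apply (v - u)

theorem torusGap_eq_fract {u v : UnitAddCircle} {x : ℝ} (hx : (x : UnitAddCircle) = v - u) :
    torusGap u v = Int.fract x := by
  rw [torusGap, ← hx, AddCircle.coe_equivIco_mk_apply]
  simp

theorem torusGap_eq_sub_of_le {u v : UnitAddCircle} {x y : ℝ}
    (hx : (x - y : ℝ) = v - u) (hx1 : x < 1) (hy : 0 ≤ y) (hyx : y ≤ x) :
    torusGap u v = x - y := by
  rw [torusGap_eq_fract hx, Int.fract_eq_self.2 ⟨by linarith, by linarith⟩]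

theorem torusGap_eq_sub_add_one_of_lt {u v : UnitAddCircle} {x y : ℝ}
    (hx : (x - y : ℝ) = v - u) (hx0 : 0 ≤ x) (hy1 : y ≤ 1) (hyx : x < y) :
    torusGap u v = x - y + 1 := by
  rw [torusGap_eq_fract hx, ← Int.fract_add_one, Int.fract_eq_self.2 ⟨by linarith, by linarith⟩]

/-- The complement of a torus interval is an open arc. -/
theorem notMem_torusInterval_iff {a b : ℝ} (ha : a ∈ Set.Icc (0 : ℝ) 1)
    (hb : b ∈ Set.Icc (0 : ℝ) 1) (hab : a ≠ b) :
    ∃ δ ≤ (1 : ℝ), ∀ v : UnitAddCircle, v ∉ torusInterval a b ↔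
      0 < torusGap (b : UnitAddCircle) v ∧ torusGap (b : UnitAddCircle) v < δ := by
  have hrep : ∀ v : UnitAddCircle, ∃ y : ℝ, 0 ≤ y ∧ y < 1 ∧ (y : UnitAddCircle) = v := fun v =>
    ⟨torusGap 0 v, torusGap_nonneg _ _, torusGap_lt_one _ _, by simp [coe_torusGap]⟩
  have hgap : ∀ y : ℝ, 0 ≤ y → y < 1 → torusGap (b : UnitAddCircle) (y : UnitAddCircle) =
      if b ≤ y then y - b else y - b + 1 := by
    intro y hy0 hy1
    split_ifs with h
    · exact torusGap_eq_sub_of_le (by simp) hy1 hb.1 h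
    · exact torusGap_eq_sub_add_one_of_lt (by simp) hy0 hb.2 (not_le.1 h)
  rcases lt_or_gt_of_ne hab with hlt | hlt
  · refine ⟨a + 1 - b, by linarith, fun v => ?_⟩
    obtain ⟨y, hy0, hy1, rfl⟩ := hrep v
    rw [hgap y hy0 hy1]
    -- The second alternative is the identification of `1` with `0`.
    have hmem : (y : UnitAddCircle) ∈ torusInterval a b ↔ (a ≤ y ∧ y ≤ b) ∨ (b = 1 ∧ y = 0) := by
      rw [torusInterval, if_pos hlt]
      constructor
      · rintro ⟨x, hx, hxy⟩
        have hxy : (x : UnitAddCircle) = y := hxy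
        rcases (hx.2.trans hb.2).lt_or_eq with hx1 | rfl
        · have : x = y := (AddCircle.coe_eq_coe_iff_of_mem_Ico (p := (1 : ℝ)) (a := 0)
            ⟨ha.1.trans hx.1, by simpa using hx1⟩ ⟨hy0, by simpa using hy1⟩).1 hxy
          subst this
          exact Or.inl hx
        · rw [AddCircle.coe_period, ← AddCircle.coe_zero] at hxy
          have : (0 : ℝ) = y := (AddCircle.coe_eq_coe_iff_of_mem_Ico (p := (1 : ℝ)) (a := 0)
            ⟨le_rfl, by simp⟩ ⟨hy0, by simpa using hy1⟩).1 hxy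
          exact Or.inr ⟨le_antisymm hb.2 hx.2, this.symm⟩
      · rintro (h | ⟨rfl, rfl⟩)
        · exact ⟨y, h, rfl⟩
        · refine ⟨1, ⟨ha.2, le_rfl⟩, ?_⟩
          change ((1 : ℝ) : UnitAddCircle) = ((0 : ℝ) : UnitAddCircle)
          rw [AddCircle.coe_period, AddCircle.coe_zero]
    rw [hmem, not_or, not_and, not_le, not_and]
    have hb1 := hb.2
    have ha0 := ha.1
    constructor
    · rintro ⟨h1, h2⟩
      split_ifs with h
      · rcases h.eq_or_lt with rfl | h'
        · exact absurd (h1 hlt.le) (lt_irrefl _)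
        · constructor <;> linarith
      · push Not at h
        have hya : y < a := by
          by_contra hya
          linarith [h1 (not_lt.1 hya)]
        refine ⟨?_, by linarith⟩
        by_contra hle
        have : b = 1 := by linarith
        exact h2 this (by linarith)
    · split_ifs with h
      · rintro ⟨h1, -⟩
        exact ⟨fun _ => by linarith, fun h2 => by linarith⟩
      · rintro ⟨h1, h2⟩
        exact ⟨fun h3 => by linarith, fun h3 h4 => by linarith⟩
  · have hb0 := hb.1
    have ha1 := ha.2
    refine ⟨a - b, by linarith, fun v => ?_⟩
    obtain ⟨y, hy0, hy1, rfl⟩ := hrep v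
    rw [hgap y hy0 hy1, coe_mem_torusInterval_of_lt hb.1 hlt hy0 hy1, not_not]
    split_ifs with h
    · constructor <;> rintro ⟨h1, h2⟩ <;> constructor <;> linarith
    · constructor <;> rintro ⟨h1, h2⟩ <;> linarith

/-- An open arc meets a finite set in a strict sublevel set of the distance from one of its
points. -/
theorem exists_notMem_torusInterval_iff_lt {α : Type*} (C : Finset α) (hC : C.Nonempty)
    (f : α → UnitAddCircle) {a b : ℝ} (ha : a ∈ Set.Icc (0 : ℝ) 1)
    (hb : b ∈ Set.Icc (0 : ℝ) 1) (hab : a ≠ b) :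
    ∃ s ∈ C, ∃ τ : ℝ, ∀ c ∈ C, f c ∉ torusInterval a b ↔ torusGap (f s) (f c) < τ := by
  classical
  obtain ⟨δ, hδ, h⟩ := notMem_torusInterval_iff ha hb hab
  rcases (C.filter fun c => f c ∉ torusInterval a b).eq_empty_or_nonempty with he | hne
  · obtain ⟨s, hs⟩ := hC
    refine ⟨s, hs, 0, fun c hc => ?_⟩
    rw [Finset.filter_eq_empty_iff] at he
    exact iff_of_false (he hc) (not_lt.2 (torusGap_nonneg _ _))
  -- The starting point is the first point of `C` in the arc after `b`.
  · obtain ⟨s, hs, hmin⟩ := Finset.exists_min_image _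
      (fun c => torusGap (b : UnitAddCircle) (f c)) hne
    rw [Finset.mem_filter, h] at hs
    refine ⟨s, hs.1, δ - torusGap (b : UnitAddCircle) (f s), fun c hc => ?_⟩
    have hcoe : ((torusGap (b : UnitAddCircle) (f c) - torusGap (b : UnitAddCircle) (f s) : ℝ) :
        UnitAddCircle) = f c - f s := by
      rw [AddCircle.coe_sub, coe_torusGap, coe_torusGap]
      abel
    have hs0 := torusGap_nonneg (b : UnitAddCircle) (f s)
    have hc0 := torusGap_nonneg (b : UnitAddCircle) (f c)
    have hs1 := torusGap_lt_one (b : UnitAddCircle) (f s)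
    have hc1 := torusGap_lt_one (b : UnitAddCircle) (f c)
    constructor
    · intro hcX
      have hle := hmin c (Finset.mem_filter.2 ⟨hc, hcX⟩)
      rw [h] at hcX
      rw [torusGap_eq_sub_of_le hcoe hc1 hs0 hle]
      linarith
    · intro hlt
      rw [h]
      rcases le_or_gt (torusGap (b : UnitAddCircle) (f s)) (torusGap (b : UnitAddCircle) (f c))
        with hle | hgt
      · rw [torusGap_eq_sub_of_le hcoe hc1 hs0 hle] at hlt
        constructor <;> linarith
      · rw [torusGap_eq_sub_add_one_of_lt hcoe hc0 hs1.le hgt] at hlt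
        -- A point between `b` and `s` would be reached only after a full turn, beyond the arc since
        -- `δ ≤ 1`.
        linarith

theorem two_pow_le_of_mem_shatteredCards_periodicBoxes {d n : ℕ} (hn : n ≠ 0)
    (h : n ∈ shatteredCards (periodicBoxes d)) :
    2 ^ n ≤ n ^ d * (n + d).choose d := by
  classical
  obtain ⟨C, rfl, hC⟩ := h
  have hCne : C.Nonempty := Finset.card_ne_zero.1 hn
  refine two_pow_card_le_of_chains C
    (fun i s => Set.range fun τ : ℝ => C.filter fun c => torusGap (s i) (c i) < τ) ?_ ?_
  · rintro i s _ ⟨τ, rfl⟩ _ ⟨τ', rfl⟩ -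
    rcases le_total τ τ' with hle | hle
    · exact Or.inl (Finset.monotone_filter_right _ fun c _ hc => lt_of_lt_of_le hc hle)
    · exact Or.inr (Finset.monotone_filter_right _ fun c _ hc => lt_of_lt_of_le hc hle)
  · intro t ht
    -- Shattering is applied to the complement, so that `t` is the part missed by the box.
    obtain ⟨_, ⟨a, b, hab, rfl⟩, hbox⟩ := hC (C \ t : Finset _) (by simp)
    choose s hs τ hτ using fun i => exists_notMem_torusInterval_iff_lt C hCne (fun c => c i)
      (hab i).1 (hab i).2.1 (hab i).2.2
    refine ⟨s, fun i => C.filter fun c => torusGap (s i i) (c i) < τ i, hs, fun i => ⟨τ i, rfl⟩, ?_⟩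
    ext c
    simp only [Finset.mem_biUnion, Finset.mem_univ, true_and, Finset.mem_filter]
    by_cases hcC : c ∈ C
    · have hc := Set.ext_iff.1 hbox c
      simp only [Set.mem_inter_iff, Set.mem_univ_pi, Finset.mem_coe, hcC, and_true,
        Finset.mem_sdiff, true_and] at hc
      rw [← not_iff_not, ← hc, not_exists]
      refine forall_congr' fun i => ?_
      rw [← not_iff_not, hτ i c hcC]
      simp [hcC]
    · exact iff_of_false (by simp [hcC]) fun h => hcC (ht h)

/-! ### Choice of parameters and asymptotics -/

open Filter Asymptotics

theorem mem_shatteredCards_of_le {α : Type*} {H : Set (Set α)} {m n : ℕ}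
    (hn : n ∈ shatteredCards H) (hmn : m ≤ n) : m ∈ shatteredCards H := by
  obtain ⟨C, rfl, hC⟩ := hn
  obtain ⟨C', hC', rfl⟩ := Finset.exists_subset_card_eq hmn
  have hsub : (C' : Set α) ⊆ C := by exact_mod_cast hC'
  refine ⟨C', rfl, fun t ht => ?_⟩
  obtain ⟨h, hh, ht'⟩ := hC t (ht.trans hsub)
  refine ⟨h, hh, ?_⟩
  rw [← Set.inter_eq_self_of_subset_right hsub, ← Set.inter_assoc, ht',
    Set.inter_eq_self_of_subset_left ht]

theorem shatteredCards_mono {α : Type*} {H K : Set (Set α)} (hHK : H ⊆ K) :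
    shatteredCards H ⊆ shatteredCards K := by
  rintro n ⟨C, hn, hC⟩
  refine ⟨C, hn, fun t ht => ?_⟩
  obtain ⟨h, hh, heq⟩ := hC t ht
  exact ⟨h, hHK hh, heq⟩

theorem periodicCubes_subset_periodicBoxes (d : ℕ) : periodicCubes d ⊆ periodicBoxes d := by
  rintro h ⟨a, b, hab, -, rfl⟩
  exact ⟨a, b, hab, rfl⟩

theorem isGreatest_vcDim {α : Type*} {H : Set (Set α)} (hne : (shatteredCards H).Nonempty)
    (hbdd : BddAbove (shatteredCards H)) : IsGreatest (shatteredCards H) (vcDim H) :=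
  ⟨Nat.sSup_mem hne hbdd, fun _ hn => le_csSup hbdd hn⟩

theorem choose_le_exp_mul_div_pow {d : ℕ} (hd : d ≠ 0) (N : ℕ) :
    (N.choose d : ℝ) ≤ (Real.exp 1 * N / d) ^ d := by
  have hd0 : (0 : ℝ) < d := by exact_mod_cast Nat.pos_of_ne_zero hd
  have h2 : (d : ℝ) ^ d / d.factorial ≤ Real.exp d :=
    Real.pow_div_factorial_le_exp (d : ℝ) hd0.le d
  have h3 : (Real.exp 1) ^ d = Real.exp d := by rw [← Real.exp_nat_mul, mul_one]
  calc (N.choose d : ℝ) ≤ (N : ℝ) ^ d / d.factorial := Nat.choose_le_pow_div d N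
    _ = ((d : ℝ) ^ d / d.factorial) * (N ^ d / d ^ d) := by field_simp
    _ ≤ Real.exp d * (N ^ d / d ^ d) := by gcongr
    _ = _ := by rw [← h3, div_pow, mul_pow]; ring

theorem two_rpow_logb_add_mul_loglog {d : ℕ} {m : ℤ} (hd : d ≠ 0) (hL : 0 < Real.logb 2 d) :
    (2 : ℝ) ^ (Real.logb 2 d + m * Real.logb 2 (Real.logb 2 d)) = d * Real.logb 2 d ^ m := by
  rw [Real.rpow_add two_pos, Real.rpow_logb two_pos (by norm_num) (by positivity), mul_comm (m : ℝ),
    Real.rpow_mul two_pos.le, Real.rpow_logb two_pos (by norm_num) hL, Real.rpow_intCast]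

theorem le_of_mem_shatteredCards_periodicBoxes {d n : ℕ} (hL : 18 ≤ Real.logb 2 d)
    (hl : 3 * Real.logb 2 (Real.logb 2 d) + 1 ≤ Real.logb 2 d)
    (hn : n ∈ shatteredCards (periodicBoxes d)) :
    (n : ℝ) ≤ d * (Real.logb 2 d + 3 * Real.logb 2 (Real.logb 2 d)) := by
  have hd : d ≠ 0 := by
    rintro rfl
    norm_num at hL
  have hd1 : (1 : ℝ) ≤ d := by exact_mod_cast Nat.one_le_iff_ne_zero.2 hd
  set L := Real.logb 2 d with hLdef
  set l := Real.logb 2 L with hldef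
  have hl0 : 0 ≤ l := Real.logb_nonneg (by norm_num) (by linarith)
  by_contra hcon
  push Not at hcon
  set x : ℝ := d * (L + 3 * l) with hx
  have hx0 : 0 ≤ x := by positivity
  -- Passing to a shattered set just larger than `x` keeps its size below `2 * d * L`.
  have hm : ⌊x⌋₊ + 1 ∈ shatteredCards (periodicBoxes d) :=
    mem_shatteredCards_of_le hn (Nat.succ_le_of_lt ((Nat.floor_lt hx0).2 hcon))
  set m := ⌊x⌋₊ + 1 with hmdef
  have hxm : x < m := by rw [hmdef]; exact_mod_cast Nat.lt_floor_add_one x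
  have hmx : (m : ℝ) ≤ x + 1 := by
    rw [hmdef]; push_cast; linarith [Nat.floor_le hx0]
  have hm2 : (m : ℝ) ≤ 2 * d * L := by nlinarith
  have hbound : (2 : ℝ) ^ m ≤ (m * (Real.exp 1 * (m + d : ℕ) / d)) ^ d := by
    have := two_pow_le_of_mem_shatteredCards_periodicBoxes (by omega) hm
    rw [mul_pow]
    calc (2 : ℝ) ^ m ≤ (m : ℝ) ^ d * (m + d).choose d := by exact_mod_cast this
      _ ≤ _ := by gcongr; exact choose_le_exp_mul_div_pow hd _
  have hbase : m * (Real.exp 1 * (m + d : ℕ) / d) ≤ d * L ^ 3 := by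
    have he : Real.exp 1 ≤ 3 := by linarith [Real.exp_one_lt_d9]
    have h1 : ((m + d : ℕ) : ℝ) ≤ 3 * d * L := by push_cast; nlinarith
    have h2 : Real.exp 1 * (m + d : ℕ) / d ≤ 9 * L := by
      rw [div_le_iff₀ (by linarith)]
      calc Real.exp 1 * (m + d : ℕ) ≤ 3 * (3 * d * L) := by gcongr
        _ = 9 * L * d := by ring
    calc m * (Real.exp 1 * (m + d : ℕ) / d) ≤ (2 * d * L) * (9 * L) := by gcongr
      _ = d * (18 * L ^ 2) := by ring
      -- The constant is absorbed by `18 ≤ L`; the resulting `L ^ 3` is the source of `3 * l`.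
      _ ≤ d * (L * L ^ 2) := by gcongr
      _ = d * L ^ 3 := by ring
  have hpow : (2 : ℝ) ^ x = (d * L ^ 3) ^ d := by
    have := two_rpow_logb_add_mul_loglog (m := 3) hd (by linarith)
    rw [hx, mul_comm, Real.rpow_mul two_pos.le, Real.rpow_natCast]
    congr 1
  have hlt : (2 : ℝ) ^ x < 2 ^ m := by
    rw [← Real.rpow_natCast]
    exact Real.rpow_lt_rpow_of_exponent_lt (by norm_num) hxm
  have : (m * (Real.exp 1 * (m + d : ℕ) / d)) ^ d ≤ (d * L ^ 3) ^ d :=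
    pow_le_pow_left₀ (by positivity) hbase d
  linarith

theorem exists_mem_shatteredCards_periodicCubes {d : ℕ} (hL : 18 ≤ Real.logb 2 d)
    (hl : 3 * Real.logb 2 (Real.logb 2 d) + 1 ≤ Real.logb 2 d)
    (hl3 : 3 ≤ Real.logb 2 (Real.logb 2 d)) :
    ∃ n ∈ shatteredCards (periodicCubes d),
      (d : ℝ) * (Real.logb 2 d - 4 * Real.logb 2 (Real.logb 2 d)) ≤ n := by
  have hd : d ≠ 0 := by
    rintro rfl
    norm_num at hL
  have hd1 : (1 : ℝ) ≤ d := by exact_mod_cast Nat.one_le_iff_ne_zero.2 hd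
  set L := Real.logb 2 d with hLdef
  set l := Real.logb 2 L with hldef
  have hL0 : 0 < L := by linarith
  have hdL : d = (2 : ℝ) ^ L :=
    (Real.rpow_logb two_pos (by norm_num) (by linarith)).symm
  have hLd : L ≤ d := by
    rw [hLdef, Real.logb_le_iff_le_rpow (by norm_num) (by linarith), Real.rpow_natCast]
    exact_mod_cast Nat.lt_two_pow_self.le
  have hdexp : (d : ℝ) ≤ Real.exp L := by
    rw [hdL, Real.rpow_def_of_pos two_pos]
    have : Real.log 2 ≤ 1 := by linarith [Real.log_two_lt_d9]
    exact Real.exp_le_exp.2 (by nlinarith)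
  -- These make `q = 2 ^ k ≤ d / L ^ 3` and `d - G ≥ d / L`, so `(d - G) / q ≥ L ^ 2`, and `exp (-L
  -- ^ 2)` beats the four factors of size at most `exp L`.
  set k := ⌊L - 3 * l⌋₊ with hk
  set G := ⌊d - d / L⌋₊ with hG
  have hdivL : d / L ≤ d := div_le_self (by linarith) (by linarith)
  have hGle : (G : ℝ) ≤ d - d / L := Nat.floor_le (by linarith)
  have hGge : d - d / L - 1 ≤ G := by linarith [Nat.lt_floor_add_one (d - d / L)]
  have hkle : (k : ℝ) ≤ L - 3 * l := Nat.floor_le (by linarith)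
  have hkge : L - 3 * l - 1 ≤ k := by linarith [Nat.lt_floor_add_one (L - 3 * l)]
  have hGd' : (G : ℝ) ≤ d := by linarith [show 0 ≤ d / L by positivity]
  have hGd : G ≤ d := by exact_mod_cast hGd'
  refine ⟨G * k, ?_, ?_⟩
  · classical
    suffices hlt : (G : ℝ) * (G * d * Fintype.card (Set (Fin k)) *
        (1 - 1 / (Fintype.card (Set (Fin k)) : ℝ)) ^ (d - G)) < 1 by
      obtain ⟨F, hF⟩ := exists_array_of_lt_one d G (Set (Fin k)) hGd hlt
      exact mul_mem_shatteredCards_periodicCubes F hF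
    rw [Fintype.card_set, Fintype.card_fin]
    push_cast
    set q : ℝ := (2 : ℝ) ^ k with hq
    have hq0 : 0 < q := by positivity
    have hq1 : 1 ≤ q := one_le_pow₀ (by norm_num)
    have hqle : q ≤ d / L ^ 3 := by
      have h := two_rpow_logb_add_mul_loglog (m := -3) hd hL0
      calc q = (2 : ℝ) ^ (k : ℝ) := (Real.rpow_natCast _ _).symm
        _ ≤ (2 : ℝ) ^ (L + ((-3 : ℤ) : ℝ) * l) :=
          Real.rpow_le_rpow_of_exponent_le (by norm_num) (by push_cast; linarith)
        _ = d / L ^ 3 := by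
          rw [h, zpow_neg, div_eq_mul_inv]
          norm_cast
    have hqd : q ≤ d := hqle.trans (div_le_self (by linarith) (one_le_pow₀ (by linarith)))
    have h0 : 0 ≤ 1 - 1 / q := by
      have : 1 / q ≤ 1 := by rw [div_le_one hq0]; exact hq1
      linarith
    have hrho : (1 - 1 / q) ^ (d - G) ≤ Real.exp (-L ^ 2) := by
      calc (1 - 1 / q) ^ (d - G) ≤ (Real.exp (-(1 / q))) ^ (d - G) :=
            pow_le_pow_left₀ h0 (Real.one_sub_le_exp_neg _) _
        _ = Real.exp (-((d - G : ℕ) / q)) := by rw [← Real.exp_nat_mul]; congr 1; ring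
        _ ≤ Real.exp (-L ^ 2) := by
          refine Real.exp_le_exp.2 (neg_le_neg ?_)
          rw [le_div_iff₀ hq0, Nat.cast_sub hGd]
          calc L ^ 2 * q ≤ L ^ 2 * (d / L ^ 3) := by gcongr
            _ = d / L := by field_simp
            _ ≤ d - G := by linarith
    calc (G : ℝ) * (G * d * q * (1 - 1 / q) ^ (d - G))
        ≤ Real.exp L * (Real.exp L * Real.exp L * Real.exp L * Real.exp (-L ^ 2)) := by
          have h1 : (G : ℝ) ≤ Real.exp L := hGd'.trans hdexp
          have h2 : q ≤ Real.exp L := hqd.trans hdexp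
          have h3 : 0 ≤ (1 - 1 / q) ^ (d - G) := pow_nonneg h0 _
          gcongr
      _ = Real.exp (L + (L + L + L + -L ^ 2)) := by simp only [Real.exp_add]
      _ < 1 := Real.exp_zero ▸ Real.exp_lt_exp.2 (by nlinarith)
  · push_cast
    have h1 : 0 ≤ L - 3 * l - 1 := by linarith
    have h2 : 0 ≤ d - d / L - 1 := by
      have : d / L ≤ d / 18 := by gcongr
      linarith
    have h3 : (d - d / L - 1) * (L - 3 * l - 1) ≤ (G : ℝ) * k := by gcongr
    -- The roundings and the `d / L` spare rows cost at most `2 * d + L ≤ 3 * d`, which `3 ≤ l`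
    -- turns into the fourth `d * l`.
    have h4 : (d / L + 1) * (L - 3 * l - 1) ≤ (d / L + 1) * L := by
      gcongr
      linarith
    have h5 : (d / L + 1) * L = d + L := by field_simp
    nlinarith

theorem isLittleO_logb_logb :
    (fun d : ℕ => Real.logb 2 (Real.logb 2 d)) =o[atTop] fun d : ℕ => Real.logb 2 (d : ℝ) := by
  have h1 : (Real.logb 2) =o[atTop] (id : ℝ → ℝ) := by
    have : Real.logb 2 = fun x => (Real.log 2)⁻¹ * Real.log x := by
      ext x; rw [Real.logb, div_eq_inv_mul]
    rw [this]
    exact Real.isLittleO_log_id_atTop.const_mul_left _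
  exact h1.comp_tendsto
    ((Real.tendsto_logb_atTop (by norm_num : (1 : ℝ) < 2)).comp tendsto_natCast_atTop_atTop)

theorem isEquivalent_mul_logb {V : ℕ → ℝ}
    (h : ∀ᶠ d : ℕ in atTop, (d : ℝ) * (Real.logb 2 d - 4 * Real.logb 2 (Real.logb 2 d)) ≤ V d ∧
      V d ≤ d * (Real.logb 2 d + 3 * Real.logb 2 (Real.logb 2 d)) ∧
      0 ≤ Real.logb 2 (Real.logb 2 d)) :
    IsEquivalent atTop V fun d : ℕ => (d : ℝ) * Real.logb 2 d := by
  have hO : (V - fun d : ℕ => (d : ℝ) * Real.logb 2 d) =O[atTop]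
      fun d : ℕ => (d : ℝ) * Real.logb 2 (Real.logb 2 d) := by
    refine IsBigO.of_bound 4 ?_
    filter_upwards [h] with d hd
    obtain ⟨h1, h2, h3⟩ := hd
    have h4 : 0 ≤ (d : ℝ) * Real.logb 2 (Real.logb 2 d) := mul_nonneg (Nat.cast_nonneg d) h3
    rw [Real.norm_of_nonneg h4, Pi.sub_apply, Real.norm_eq_abs, abs_le]
    constructor <;> nlinarith
  exact hO.trans_isLittleO ((isBigO_refl _ _).mul_isLittleO isLittleO_logb_logb)

theorem eventually_vcDim_bounds : ∀ᶠ d : ℕ in atTop,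
    (IsGreatest (shatteredCards (periodicCubes d)) (vcDim (periodicCubes d)) ∧
      IsGreatest (shatteredCards (periodicBoxes d)) (vcDim (periodicBoxes d)) ∧
      (d : ℝ) * (Real.logb 2 d - 4 * Real.logb 2 (Real.logb 2 d)) ≤
        (vcDim (periodicCubes d) : ℝ) ∧
      vcDim (periodicCubes d) ≤ vcDim (periodicBoxes d) ∧
      (vcDim (periodicBoxes d) : ℝ) ≤
        (d : ℝ) * (Real.logb 2 d + 3 * Real.logb 2 (Real.logb 2 d))) ∧
    0 ≤ Real.logb 2 (Real.logb 2 d) := by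
  have hLtop : Tendsto (fun d : ℕ => Real.logb 2 (d : ℝ)) atTop atTop :=
    (Real.tendsto_logb_atTop (by norm_num)).comp tendsto_natCast_atTop_atTop
  have hltop : Tendsto (fun d : ℕ => Real.logb 2 (Real.logb 2 d)) atTop atTop :=
    (Real.tendsto_logb_atTop (by norm_num)).comp hLtop
  filter_upwards [hLtop.eventually_ge_atTop 18, hltop.eventually_ge_atTop 3,
    isLittleO_logb_logb.bound (show (0 : ℝ) < 1 / 6 by norm_num)] with d hL hl3 hlo
  -- From `l ≤ L / 6` and `18 ≤ L`, `3 * l + 1 ≤ L / 2 + 1 ≤ L`.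
  have hl : 3 * Real.logb 2 (Real.logb 2 d) + 1 ≤ Real.logb 2 d := by
    rw [Real.norm_of_nonneg (by linarith), Real.norm_of_nonneg (by linarith)] at hlo
    linarith
  obtain ⟨n, hn, hnle⟩ := exists_mem_shatteredCards_periodicCubes hL hl hl3
  have hsub := shatteredCards_mono (periodicCubes_subset_periodicBoxes d)
  have hbdd : BddAbove (shatteredCards (periodicBoxes d)) :=
    ⟨_, fun m hm => Nat.le_floor (le_of_mem_shatteredCards_periodicBoxes hL hl hm)⟩
  have hC := isGreatest_vcDim ⟨n, hn⟩ (hbdd.mono hsub)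
  have hB := isGreatest_vcDim ⟨n, hsub hn⟩ hbdd
  exact ⟨⟨hC, hB, hnle.trans (by exact_mod_cast hC.2 hn), hB.2 (hsub hC.1),
    le_of_mem_shatteredCards_periodicBoxes hL hl hB.1⟩, by linarith⟩

theorem theorem1 :
    (∃ d₀ : ℕ, ∀ d : ℕ, d₀ ≤ d →
      IsGreatest (shatteredCards (periodicCubes d)) (vcDim (periodicCubes d)) ∧
      IsGreatest (shatteredCards (periodicBoxes d)) (vcDim (periodicBoxes d)) ∧
      (d : ℝ) * (Real.logb 2 d - 4 * Real.logb 2 (Real.logb 2 d)) ≤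
        (vcDim (periodicCubes d) : ℝ) ∧
      vcDim (periodicCubes d) ≤ vcDim (periodicBoxes d) ∧
      (vcDim (periodicBoxes d) : ℝ) ≤
        (d : ℝ) * (Real.logb 2 d + 3 * Real.logb 2 (Real.logb 2 d))) ∧
    Asymptotics.IsEquivalent Filter.atTop
      (fun d : ℕ => (vcDim (periodicBoxes d) : ℝ))
      (fun d : ℕ => (vcDim (periodicCubes d) : ℝ)) ∧
    Asymptotics.IsEquivalent Filter.atTop
      (fun d : ℕ => (vcDim (periodicCubes d) : ℝ))
      (fun d : ℕ => (d : ℝ) * Real.logb 2 d) ∧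
    Asymptotics.IsEquivalent Filter.atTop
      (fun d : ℕ => (vcDim (periodicBoxes d) : ℝ))
      (fun d : ℕ => (d : ℝ) * Real.logb 2 d) := by
  have hcubes := isEquivalent_mul_logb (V := fun d => (vcDim (periodicCubes d) : ℝ)) <| by
    filter_upwards [eventually_vcDim_bounds] with d hd
    obtain ⟨⟨-, -, h1, h2, h3⟩, h4⟩ := hd
    exact ⟨h1, le_trans (by exact_mod_cast h2) h3, h4⟩
  have hboxes := isEquivalent_mul_logb (V := fun d => (vcDim (periodicBoxes d) : ℝ)) <| by
    filter_upwards [eventually_vcDim_bounds] with d hd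
    obtain ⟨⟨-, -, h1, h2, h3⟩, h4⟩ := hd
    exact ⟨h1.trans (by exact_mod_cast h2), h3, h4⟩
  exact ⟨eventually_atTop.1 (eventually_vcDim_bounds.mono fun _ h => h.1),
    hboxes.trans hcubes.symm, hcubes, hboxes⟩
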